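/- Let $n\ge 3$ and let $P(\lambda)=\lambda(J_1+R_1)+(J_2+R_2)\in\mathbb C^{n,n}[\lambda]$, where $J_1,J_2$ are skew-Hermitian ($J_i^*=-J_i$) and $R_1,R_2$ are Hermitian positive semidefinite. Let $$W(P)=\{\mu\in\mathbb C : x^*P(\mu)x=0\text{ for some }x\in\mathbb C^n\setminus\{0\}\}$$ be the numerical range of $P$, and put $$\beta_\pm=\sup\{\beta\ge 0 : R_1+R_2\pm\beta\,(\mathrm iJ_1)>0\}\in[0,\infty]$$ whenever the set is nonempty (otherwise $\beta_\pm$ is undefined; "$\beta_\pm>0$" includes that it is defined). Here $M>0$ means that $M$ is Hermitian positive definite. Matrices $A_1,\dots,A_k\in\mathbb C^{n,n}$ have a common isotropic vector if there is a nonzero $x\in\mathbb C^n$ with $x^*A_jx=0$ for all $j$. Let $\arg z\in(-\pi,\pi]$ be the principal argument and $\arctan(\infty)=\pi/2$. (i) If $R_1,R_2,J_1$ have no common isotropic vector, then either $\beta_+>0$ and $$W(P)\cap\{z\in\mathbb C : \operatorname{Re}z>0,\ 0<\operatorname{Im}z<\beta_+,\ 0<\arg z<\arctan(\beta_+)\}=\emptyset,$$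 or $\beta_->0$ and $$W(P)\cap\{z\in\mathbb C : \operatorname{Re}z>0,\ -\beta_-<\operatorname{Im}z<0,\ -\arctan(\beta_-)<\arg z<0\}=\emptyset$$ (or both). (ii) $R_1,R_2$ have no common isotropic vector if and only if $\ker R_1\cap\ker R_2=\{0\}$. In this case $\beta_+>0$ and $\beta_->0$, and $$W(P)\cap\{z\in\mathbb C : \operatorname{Re}z>0,\ 0\le\operatorname{Im}z<\beta_+,\ 0\le\arg z<\arctan(\beta_+)\}=\emptyset,$$ $$W(P)\cap\{z\in\mathbb C : \operatorname{Re}z>0,\ -\beta_-<\operatorname{Im}z\le 0,\ -\arctan(\beta_-)<\arg z\le 0\}=\emptyset.$$ -/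

import Mathlib

open scoped Matrix ComplexOrder

/-- The matrices `A i` have a common isotropic vector: some nonzero complex `x` satisfies
`x* (A i) x = 0` for all `i`. -/
def HasCommonIsotropicVector {n : ℕ} {ι : Type*} (A : ι → Matrix (Fin n) (Fin n) ℂ) : Prop :=
  ∃ x : Fin n → ℂ, x ≠ 0 ∧ ∀ i, star x ⬝ᵥ (A i *ᵥ x) = 0

/-- The matrix pencil `P(z) = z (J₁ + R₁) + (J₂ + R₂)`, as a matrix-valued function of `z`. -/
def pencil {n : ℕ} (J₁ R₁ J₂ R₂ : Matrix (Fin n) (Fin n) ℂ) (z : ℂ) : Matrix (Fin n) (Fin n) ℂ :=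
  z • (J₁ + R₁) + (J₂ + R₂)

/-- The numerical range `W(L)` of a matrix function (in particular of a matrix pencil) `L`:
all `μ` with `x* L(μ) x = 0` for some nonzero complex vector `x`. -/
def matrixNumericalRange {n : ℕ} (L : ℂ → Matrix (Fin n) (Fin n) ℂ) : Set ℂ :=
  {μ | ∃ x : Fin n → ℂ, x ≠ 0 ∧ star x ⬝ᵥ (L μ *ᵥ x) = 0}

/-- `β₊ = sup {β ≥ 0 | R₁ + R₂ + β (i J₁) > 0}`, an extended real, possibly `⊤`.
If the set is empty, the value is `⊥` (that is, `β₊` is not defined as a number), so that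
`0 < betaPlus` entails that the set is nonempty. -/
noncomputable def betaPlus {n : ℕ} (R₁ R₂ J₁ : Matrix (Fin n) (Fin n) ℂ) : EReal :=
  sSup ((fun β : ℝ => (β : EReal)) ''
    {β : ℝ | 0 ≤ β ∧ (R₁ + R₂ + (β : ℂ) • (Complex.I • J₁)).PosDef})

/-- `β₋ = sup {β ≥ 0 | R₁ + R₂ - β (i J₁) > 0}`, with the same conventions as `β₊`. -/
noncomputable def betaMinus {n : ℕ} (R₁ R₂ J₁ : Matrix (Fin n) (Fin n) ℂ) : EReal :=
  sSup ((fun β : ℝ => (β : EReal)) ''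
    {β : ℝ | 0 ≤ β ∧ (R₁ + R₂ - (β : ℂ) • (Complex.I • J₁)).PosDef})

/-- The arctangent on the extended reals, with `arctan (±∞) = ±π/2`. -/
noncomputable def arctanEReal (b : EReal) : ℝ :=
  if b = ⊤ then Real.pi / 2 else if b = ⊥ then -(Real.pi / 2) else Real.arctan b.toReal

/-- `Re z > 0`, `0 ≤ Im z < b`, `0 ≤ arg z < arctan b`. -/
def upperRegion (b : EReal) : Set ℂ :=
  {z | 0 < z.re ∧ 0 ≤ z.im ∧ (z.im : EReal) < b ∧ 0 ≤ z.arg ∧ z.arg < arctanEReal b}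

/-- `Re z > 0`, `-b < Im z ≤ 0`, `-arctan b < arg z ≤ 0`. -/
def lowerRegion (b : EReal) : Set ℂ :=
  {z | 0 < z.re ∧ -b < (z.im : EReal) ∧ z.im ≤ 0 ∧ -arctanEReal b < z.arg ∧ z.arg ≤ 0}

/-- The part of `upperRegion b` strictly above the real axis:
`Re z > 0`, `0 < Im z < b`, `0 < arg z < arctan b`. -/
def openUpperRegion (b : EReal) : Set ℂ :=
  {z | z ∈ upperRegion b ∧ 0 < z.im}

/-- The part of `lowerRegion b` strictly below the real axis:
`Re z > 0`, `-b < Im z < 0`, `-arctan b < arg z < 0`. -/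
def openLowerRegion (b : EReal) : Set ℂ :=
  {z | z ∈ lowerRegion b ∧ z.im < 0}

/-! Only the real part of `x* P(z) x = 0` is used. With `r₁, r₂, h` the forms of `R₁, R₂, iJ₁` at
`x`, it says `Re z · r₁ + r₂ + Im z · h = 0` (`re_pencil_form_eq_zero`). In the upper region some
admissible `β` exceeds both `Im z` and `Im z / Re z`, and then `r₁ + r₂ + β h > 0` contradicts the
equation (`false_of_weighted_sum_eq_zero`). The lower region follows by conjugation.

Positivity of `β₊` or `β₋` comes from compactness once `iJ₁` is definite on `ker (R₁ + R₂)`. Without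
a common isotropic vector it is: a form of both signs on a subspace vanishes somewhere on it. -/

/-- The real quadratic form `x ↦ Re (x* M x)` of a complex matrix. -/
noncomputable def reQuadForm {n : ℕ} (M : Matrix (Fin n) (Fin n) ℂ) (x : Fin n → ℂ) : ℝ :=
  (star x ⬝ᵥ (M *ᵥ x)).re

/-! ### Quadratic forms: perturbation and isotropic vectors. -/

section reQuadForm

variable {n : ℕ} {M S H : Matrix (Fin n) (Fin n) ℂ}

theorem reQuadForm_add (M N : Matrix (Fin n) (Fin n) ℂ) (x : Fin n → ℂ) :
    reQuadForm (M + N) x = reQuadForm M x + reQuadForm N x := by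
  simp [reQuadForm, Matrix.add_mulVec]

theorem reQuadForm_neg (M : Matrix (Fin n) (Fin n) ℂ) (x : Fin n → ℂ) :
    reQuadForm (-M) x = -reQuadForm M x := by
  simp [reQuadForm, Matrix.neg_mulVec]

theorem reQuadForm_ofReal_smul (c : ℝ) (M : Matrix (Fin n) (Fin n) ℂ) (x : Fin n → ℂ) :
    reQuadForm ((c : ℂ) • M) x = c * reQuadForm M x := by
  simp [reQuadForm, Matrix.smul_mulVec]

theorem reQuadForm_smul_vec (c : ℝ) (M : Matrix (Fin n) (Fin n) ℂ) (x : Fin n → ℂ) :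
    reQuadForm M ((c : ℂ) • x) = c ^ 2 * reQuadForm M x := by
  have h : star ((c : ℂ) • x) = (c : ℂ) • star x := by
    rw [star_smul]; simp
  simp only [reQuadForm, h, Matrix.mulVec_smul, smul_dotProduct, dotProduct_smul, smul_eq_mul,
    Complex.re_ofReal_mul]
  ring

theorem continuous_reQuadForm (M : Matrix (Fin n) (Fin n) ℂ) : Continuous (reQuadForm M) := by
  unfold reQuadForm
  fun_prop

theorem Matrix.IsHermitian.dotProduct_mulVec_eq_reQuadForm (hM : M.IsHermitian) (x : Fin n → ℂ) :
    star x ⬝ᵥ (M *ᵥ x) = (reQuadForm M x : ℂ) := by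
  apply Complex.ext
  · simp [reQuadForm]
  · simpa using hM.im_star_dotProduct_mulVec_self x

theorem Matrix.PosSemidef.reQuadForm_nonneg (hM : M.PosSemidef) (x : Fin n → ℂ) :
    0 ≤ reQuadForm M x :=
  (Complex.le_def.1 (hM.dotProduct_mulVec_nonneg x)).1

theorem Matrix.PosSemidef.reQuadForm_eq_zero_iff (hM : M.PosSemidef) (x : Fin n → ℂ) :
    reQuadForm M x = 0 ↔ M *ᵥ x = 0 := by
  rw [← hM.dotProduct_mulVec_zero_iff, hM.isHermitian.dotProduct_mulVec_eq_reQuadForm]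
  simp

theorem Matrix.PosDef.reQuadForm_pos (hM : M.PosDef) {x : Fin n → ℂ} (hx : x ≠ 0) :
    0 < reQuadForm M x :=
  (Complex.lt_def.1 (hM.dotProduct_mulVec_pos hx)).1

theorem Matrix.IsHermitian.posDef_of_reQuadForm_pos (hM : M.IsHermitian)
    (h : ∀ x, x ≠ 0 → 0 < reQuadForm M x) : M.PosDef :=
  .of_dotProduct_mulVec_pos hM fun x hx ↦ by
    rw [hM.dotProduct_mulVec_eq_reQuadForm]
    exact_mod_cast h x hx

/-- If `S` is positive semidefinite and the Hermitian matrix `H` is positive on `ker S`, then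
`S + β H` is positive definite for some `β > 0`. -/
theorem Matrix.PosSemidef.exists_posDef_add_smul (hS : S.PosSemidef) (hH : H.IsHermitian)
    (hpos : ∀ x, x ≠ 0 → S *ᵥ x = 0 → 0 < reQuadForm H x) :
    ∃ β : ℝ, 0 < β ∧ (S + (β : ℂ) • H).PosDef := by
  -- Since `S ≥ 0`, these open sets grow as `β` decreases, so compactness puts the unit sphere
  -- inside a single one.
  let U (β : Set.Ioi (0 : ℝ)) : Set (Fin n → ℂ) :=
    {x | 0 < reQuadForm S x + β * reQuadForm H x}
  have : Nonempty (Set.Ioi (0 : ℝ)) := ⟨⟨1, Set.mem_Ioi.2 one_pos⟩⟩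
  have hU_anti : Antitone U := by
    rintro ⟨β, hβ⟩ ⟨γ, hγ⟩ hβγ x hx
    have hS0 := hS.reQuadForm_nonneg x
    have hβ0 : 0 < β := hβ
    have hγ0 : 0 < γ := hγ
    simp only [Subtype.mk_le_mk, U, Set.mem_ofPred_eq] at *
    rcases le_or_gt 0 (reQuadForm H x) with h | h
    · rcases hS0.eq_or_lt with h0 | h0
      · have : 0 < reQuadForm H x := by
          refine h.lt_of_ne fun h' ↦ ?_
          rw [← h', ← h0] at hx
          simp at hx
        positivity
      · positivity
    · nlinarith
  obtain ⟨⟨β, hβ⟩, hsub⟩ := (isCompact_sphere (0 : Fin n → ℂ) 1).elim_directed_cover U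
    (fun β ↦ isOpen_lt continuous_const
      ((continuous_reQuadForm S).add (continuous_const.mul (continuous_reQuadForm H))))
    (by
      intro x hx
      have hx0 : x ≠ 0 := by
        rintro rfl
        simp at hx
      rw [Set.mem_iUnion]
      rcases (hS.reQuadForm_nonneg x).eq_or_lt with h0 | h0
      · have := hpos x hx0 ((hS.reQuadForm_eq_zero_iff x).1 h0.symm)
        refine ⟨⟨1, Set.mem_Ioi.2 one_pos⟩, ?_⟩
        simp only [U, Set.mem_ofPred_eq, ← h0]
        simpa using this
      · have hc : 0 < |reQuadForm H x| + 1 := by positivity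
        refine ⟨⟨reQuadForm S x / (|reQuadForm H x| + 1), div_pos h0 hc⟩, ?_⟩
        simp only [U, Set.mem_ofPred_eq]
        have : reQuadForm S x + reQuadForm S x / (|reQuadForm H x| + 1) * reQuadForm H x =
            reQuadForm S x / (|reQuadForm H x| + 1) *
              (|reQuadForm H x| + 1 + reQuadForm H x) := by
          field_simp
        rw [this]
        exact mul_pos (div_pos h0 hc) (by linarith [neg_abs_le (reQuadForm H x)]))
    hU_anti.directed_le
  refine ⟨β, hβ, (hS.isHermitian.add ?_).posDef_of_reQuadForm_pos fun x hx ↦ ?_⟩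
  · rw [Matrix.IsHermitian, Matrix.conjTranspose_smul, hH.eq]
    simp
  · have hx' : 0 < ‖x‖ := norm_pos_iff.2 hx
    have h := hsub (show ((‖x‖⁻¹ : ℝ) : ℂ) • x ∈ Metric.sphere (0 : Fin n → ℂ) 1 by
      simp [norm_smul, hx'.ne'])
    simp only [U, Set.mem_ofPred_eq, reQuadForm_smul_vec] at h
    rw [reQuadForm_add, reQuadForm_ofReal_smul]
    have h2 : 0 < ‖x‖⁻¹ ^ 2 := by positivity
    refine pos_of_mul_pos_right (a := ‖x‖⁻¹ ^ 2) ?_ h2.le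
    linarith

/-- A real quadratic form taking values of both signs on a subspace has a nonzero isotropic vector
in that subspace. -/
theorem exists_isotropic_of_neg_of_pos (K : Submodule ℂ (Fin n → ℂ)) {x y : Fin n → ℂ}
    (hx : x ∈ K) (hy : y ∈ K) (hMx : reQuadForm M x < 0) (hMy : 0 < reQuadForm M y) :
    ∃ z ∈ K, z ≠ 0 ∧ reQuadForm M z = 0 := by
  let f (t : ℝ) : Fin n → ℂ := ((1 - t : ℝ) : ℂ) • x + (t : ℂ) • y
  have hf : Continuous f := by
    unfold f
    fun_prop
  obtain ⟨t, -, ht⟩ := intermediate_value_Icc (zero_le_one' ℝ)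
    ((continuous_reQuadForm M).comp hf).continuousOn
    (show (0 : ℝ) ∈ Set.Icc _ _ by
      constructor
      · simpa [f] using hMx.le
      · simpa [f] using hMy.le)
  refine ⟨f t, K.add_mem (K.smul_mem _ hx) (K.smul_mem _ hy), fun h0 ↦ ?_, ht⟩
  -- Proportional vectors cannot carry form values of opposite sign, so both coefficients would
  -- vanish.
  have h1 : ((1 - t : ℝ) : ℂ) • x = ((-t : ℝ) : ℂ) • y := by
    rw [eq_neg_of_add_eq_zero_left h0]
    simp
  have h2 := congrArg (reQuadForm M) h1
  rw [reQuadForm_smul_vec, reQuadForm_smul_vec] at h2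
  have h3 : (1 - t) ^ 2 * reQuadForm M x ≤ 0 :=
    mul_nonpos_of_nonneg_of_nonpos (sq_nonneg _) hMx.le
  have h4 : 0 ≤ (-t) ^ 2 * reQuadForm M y := mul_nonneg (sq_nonneg _) hMy.le
  have h5 : (1 - t) ^ 2 = 0 := (mul_eq_zero.1 (by linarith)).resolve_right hMx.ne
  have h6 : (-t) ^ 2 = 0 := (mul_eq_zero.1 (by linarith)).resolve_right hMy.ne'
  have h7 := pow_eq_zero_iff (two_ne_zero) |>.1 h5
  have h8 := pow_eq_zero_iff (two_ne_zero) |>.1 h6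
  linarith

end reQuadForm

/-! ### Geometry of the regions. -/

section regions

theorem im_div_re_lt_of_arg_lt_arctanEReal {b : EReal} (hb : b ≠ ⊥) {z : ℂ} (hz : 0 < z.re)
    (h : z.arg < arctanEReal b) : ((z.im / z.re : ℝ) : EReal) < b := by
  unfold arctanEReal at h
  split_ifs at h with h1
  · rw [h1]
    exact EReal.coe_lt_top _
  · have harg := abs_lt.1 (Complex.abs_arg_lt_pi_div_two_iff.2 (.inl hz))
    rw [← Real.arctan_tan harg.1 harg.2, Real.arctan_lt_arctan_iff, Complex.tan_arg] at h
    rw [← EReal.coe_toReal h1 hb]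
    exact_mod_cast h

theorem conj_mem_upperRegion {b : EReal} {z : ℂ} (hz : z ∈ lowerRegion b) :
    (starRingEnd ℂ) z ∈ upperRegion b := by
  obtain ⟨h1, h2, h3, h4, h5⟩ := hz
  have harg : z.arg ≠ Real.pi := fun h ↦ by
    have := Real.pi_pos
    linarith
  simp only [upperRegion, Set.mem_ofPred_eq, Complex.conj_re, Complex.conj_im, Complex.arg_conj,
    harg, if_false]
  refine ⟨h1, by linarith, ?_, by linarith, by linarith⟩
  rw [EReal.coe_neg]
  exact EReal.neg_lt_comm.1 h2

theorem betaMinus_eq_betaPlus_neg {n : ℕ} (R₁ R₂ J₁ : Matrix (Fin n) (Fin n) ℂ) :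
    betaMinus R₁ R₂ J₁ = betaPlus R₁ R₂ (-J₁) := by
  simp [betaMinus, betaPlus, sub_eq_add_neg]

theorem betaPlus_pos {n : ℕ} {R₁ R₂ J₁ : Matrix (Fin n) (Fin n) ℂ} {β : ℝ} (hβ : 0 < β)
    (h : (R₁ + R₂ + (β : ℂ) • (Complex.I • J₁)).PosDef) : 0 < betaPlus R₁ R₂ J₁ :=
  lt_sSup_iff.2 ⟨β, ⟨β, ⟨hβ.le, h⟩, rfl⟩, by exact_mod_cast hβ⟩

/-- A point of the upper region is dominated by an admissible parameter `β`. -/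
theorem exists_posDef_of_mem_upperRegion {n : ℕ} {R₁ R₂ J₁ : Matrix (Fin n) (Fin n) ℂ} {z : ℂ}
    (hz : z ∈ upperRegion (betaPlus R₁ R₂ J₁)) :
    ∃ β : ℝ, z.im < β ∧ z.im < β * z.re ∧
      (R₁ + R₂ + (β : ℂ) • (Complex.I • J₁)).PosDef := by
  obtain ⟨h1, h2, h3, h4, h5⟩ := hz
  have h6 := im_div_re_lt_of_arg_lt_arctanEReal (bot_le.trans_lt h3).ne' h1 h5
  obtain ⟨_, ⟨β, ⟨-, hβ⟩, rfl⟩, hlt⟩ := lt_sSup_iff.1 (max_lt h3 h6)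
  obtain ⟨h7, h8⟩ : (z.im : EReal) < β ∧ ((z.im / z.re : ℝ) : EReal) < β := max_lt_iff.1 hlt
  exact ⟨β, by exact_mod_cast h7, (div_lt_iff₀ h1).1 (by exact_mod_cast h8), hβ⟩

end regions

/-- If `h < 0`, then `c|h| < min(1, a) β|h| < min(1, a)(r₁ + r₂) ≤ a r₁ + r₂`. If `h ≥ 0`, every
summand vanishes; `hne` then excludes the case `c = r₁ = r₂ = 0`, which is consistent. -/
theorem false_of_weighted_sum_eq_zero {a c β r₁ r₂ h : ℝ} (hr₁ : 0 ≤ r₁) (hr₂ : 0 ≤ r₂)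
    (ha : 0 < a) (hc : 0 ≤ c) (hcβ : c < β) (hcβa : c < β * a)
    (heq : a * r₁ + r₂ + c * h = 0) (hpos : 0 < r₁ + r₂ + β * h)
    (hne : 0 < c ∨ 0 < r₁ + r₂) : False := by
  have har : 0 ≤ a * r₁ := mul_nonneg ha.le hr₁
  rcases le_or_gt 0 h with hh | hh
  · have hch : 0 ≤ c * h := mul_nonneg hc hh
    have e1 : r₁ = 0 := (mul_eq_zero.1 (show a * r₁ = 0 by linarith)).resolve_left ha.ne'
    have e2 : r₂ = 0 := by linarith
    rcases hne with hne | hne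
    · have e3 : h = 0 := (mul_eq_zero.1 (show c * h = 0 by linarith)).resolve_left hne.ne'
      rw [e1, e2, e3] at hpos
      simp at hpos
    · linarith
  · rcases le_or_gt a 1 with h1 | h1
    · nlinarith [mul_pos ha hpos, mul_pos (sub_pos.2 hcβa) (neg_pos.2 hh),
        mul_nonneg (sub_nonneg.2 h1) hr₂]
    · nlinarith [mul_pos (sub_pos.2 hcβ) (neg_pos.2 hh), mul_nonneg (sub_nonneg.2 h1.le) hr₁]

/-! ### The pencil and its numerical range. -/

section pencil

variable {n : ℕ} {J₁ R₁ J₂ R₂ : Matrix (Fin n) (Fin n) ℂ}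

theorem isHermitian_I_smul {J : Matrix (Fin n) (Fin n) ℂ} (hJ : Jᴴ = -J) :
    (Complex.I • J).IsHermitian := by
  rw [Matrix.IsHermitian, Matrix.conjTranspose_smul, hJ]
  simp

theorem dotProduct_mulVec_of_conjTranspose_eq_neg {J : Matrix (Fin n) (Fin n) ℂ} (hJ : Jᴴ = -J)
    (x : Fin n → ℂ) :
    star x ⬝ᵥ (J *ᵥ x) = -Complex.I * (reQuadForm (Complex.I • J) x : ℂ) := by
  rw [← (isHermitian_I_smul hJ).dotProduct_mulVec_eq_reQuadForm, Matrix.smul_mulVec,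
    dotProduct_smul, smul_eq_mul, ← mul_assoc]
  simp

/-- Skew-Hermitian forms are purely imaginary, so `J₂` drops out and `J₁` contributes only through
`Im z`. -/
theorem re_pencil_form_eq_zero (hJ₁ : J₁ᴴ = -J₁) (hJ₂ : J₂ᴴ = -J₂)
    (hR₁ : R₁.IsHermitian) (hR₂ : R₂.IsHermitian) {z : ℂ} {x : Fin n → ℂ}
    (hx : star x ⬝ᵥ (pencil J₁ R₁ J₂ R₂ z *ᵥ x) = 0) :
    z.re * reQuadForm R₁ x + reQuadForm R₂ x +
      z.im * reQuadForm (Complex.I • J₁) x = 0 := by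
  rw [pencil, Matrix.add_mulVec, Matrix.smul_mulVec, Matrix.add_mulVec, Matrix.add_mulVec,
    dotProduct_add, dotProduct_smul, dotProduct_add, dotProduct_add,
    dotProduct_mulVec_of_conjTranspose_eq_neg hJ₁, dotProduct_mulVec_of_conjTranspose_eq_neg hJ₂,
    hR₁.dotProduct_mulVec_eq_reQuadForm, hR₂.dotProduct_mulVec_eq_reQuadForm] at hx
  have := congrArg Complex.re hx
  simp at this
  linarith

theorem notMem_upperRegion_of_form_eq_zero (hR₁ : R₁.PosSemidef) (hR₂ : R₂.PosSemidef)
    {z : ℂ} {x : Fin n → ℂ} (hx : x ≠ 0)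
    (heq : z.re * reQuadForm R₁ x + reQuadForm R₂ x +
      z.im * reQuadForm (Complex.I • J₁) x = 0)
    (hne : 0 < z.im ∨ 0 < reQuadForm R₁ x + reQuadForm R₂ x) :
    z ∉ upperRegion (betaPlus R₁ R₂ J₁) := by
  intro hz
  obtain ⟨β, h1, h2, hβ⟩ := exists_posDef_of_mem_upperRegion hz
  have hpos := hβ.reQuadForm_pos hx
  rw [reQuadForm_add, reQuadForm_add, reQuadForm_ofReal_smul] at hpos
  exact false_of_weighted_sum_eq_zero (hR₁.reQuadForm_nonneg x) (hR₂.reQuadForm_nonneg x)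
    hz.1 hz.2.1 h1 h2 heq hpos hne

/-- The real equation is invariant under replacing `(z, J₁)` by `(conj z, -J₁)`, which exchanges the
two half-planes. -/
theorem notMem_lowerRegion_of_form_eq_zero (hR₁ : R₁.PosSemidef) (hR₂ : R₂.PosSemidef)
    {z : ℂ} {x : Fin n → ℂ} (hx : x ≠ 0)
    (heq : z.re * reQuadForm R₁ x + reQuadForm R₂ x +
      z.im * reQuadForm (Complex.I • J₁) x = 0)
    (hne : z.im < 0 ∨ 0 < reQuadForm R₁ x + reQuadForm R₂ x) :
    z ∉ lowerRegion (betaMinus R₁ R₂ J₁) := by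
  rw [betaMinus_eq_betaPlus_neg]
  intro hz
  refine notMem_upperRegion_of_form_eq_zero hR₁ hR₂ hx ?_ ?_ (conj_mem_upperRegion hz)
  · rw [smul_neg, reQuadForm_neg, Complex.conj_re, Complex.conj_im, neg_mul_neg]
    exact heq
  · simpa using hne

theorem Matrix.PosSemidef.add_mulVec_eq_zero_iff (hR₁ : R₁.PosSemidef) (hR₂ : R₂.PosSemidef)
    (x : Fin n → ℂ) : (R₁ + R₂) *ᵥ x = 0 ↔ R₁ *ᵥ x = 0 ∧ R₂ *ᵥ x = 0 := by
  rw [← (hR₁.add hR₂).reQuadForm_eq_zero_iff, ← hR₁.reQuadForm_eq_zero_iff,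
    ← hR₂.reQuadForm_eq_zero_iff, reQuadForm_add]
  exact add_eq_zero_iff_of_nonneg (hR₁.reQuadForm_nonneg x) (hR₂.reQuadForm_nonneg x)

theorem hasCommonIsotropicVector_pair_iff (hR₁ : R₁.PosSemidef) (hR₂ : R₂.PosSemidef) :
    HasCommonIsotropicVector ![R₁, R₂] ↔ ∃ x, x ≠ 0 ∧ R₁ *ᵥ x = 0 ∧ R₂ *ᵥ x = 0 := by
  simp [HasCommonIsotropicVector, Fin.forall_fin_two, hR₁.dotProduct_mulVec_zero_iff,
    hR₂.dotProduct_mulVec_zero_iff]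

theorem hasCommonIsotropicVector_triple_iff (hR₁ : R₁.PosSemidef) (hR₂ : R₂.PosSemidef)
    (hJ₁ : J₁ᴴ = -J₁) :
    HasCommonIsotropicVector ![R₁, R₂, J₁] ↔
      ∃ x, x ≠ 0 ∧ (R₁ + R₂) *ᵥ x = 0 ∧ reQuadForm (Complex.I • J₁) x = 0 := by
  simp [HasCommonIsotropicVector, Fin.forall_fin_succ, hR₁.dotProduct_mulVec_zero_iff,
    hR₂.dotProduct_mulVec_zero_iff, dotProduct_mulVec_of_conjTranspose_eq_neg hJ₁,
    hR₁.add_mulVec_eq_zero_iff hR₂, and_assoc]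

theorem betaPlus_pos_of_pos_on_ker (hJ₁ : J₁ᴴ = -J₁) (hR₁ : R₁.PosSemidef) (hR₂ : R₂.PosSemidef)
    (h : ∀ x, x ≠ 0 → (R₁ + R₂) *ᵥ x = 0 → 0 < reQuadForm (Complex.I • J₁) x) :
    0 < betaPlus R₁ R₂ J₁ := by
  obtain ⟨β, hβ, hpd⟩ := (hR₁.add hR₂).exists_posDef_add_smul (isHermitian_I_smul hJ₁) h
  exact betaPlus_pos hβ hpd

theorem betaMinus_pos_of_neg_on_ker (hJ₁ : J₁ᴴ = -J₁) (hR₁ : R₁.PosSemidef) (hR₂ : R₂.PosSemidef)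
    (h : ∀ x, x ≠ 0 → (R₁ + R₂) *ᵥ x = 0 → reQuadForm (Complex.I • J₁) x < 0) :
    0 < betaMinus R₁ R₂ J₁ := by
  rw [betaMinus_eq_betaPlus_neg]
  refine betaPlus_pos_of_pos_on_ker (by simp [hJ₁]) hR₁ hR₂ fun x hx hk ↦ ?_
  rw [smul_neg, reQuadForm_neg]
  linarith [h x hx hk]

theorem betaPlus_pos_or_betaMinus_pos (hJ₁ : J₁ᴴ = -J₁) (hR₁ : R₁.PosSemidef)
    (hR₂ : R₂.PosSemidef) (h : ¬ HasCommonIsotropicVector ![R₁, R₂, J₁]) :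
    0 < betaPlus R₁ R₂ J₁ ∨ 0 < betaMinus R₁ R₂ J₁ := by
  rw [hasCommonIsotropicVector_triple_iff hR₁ hR₂ hJ₁] at h
  by_cases hneg : ∃ x, x ≠ 0 ∧ (R₁ + R₂) *ᵥ x = 0 ∧ reQuadForm (Complex.I • J₁) x < 0
  · obtain ⟨x, -, hxk, hxn⟩ := hneg
    refine .inr (betaMinus_pos_of_neg_on_ker hJ₁ hR₁ hR₂ fun y hy hyk ↦ ?_)
    by_contra! hyn
    rcases hyn.eq_or_lt with h0 | h0
    · exact h ⟨y, hy, hyk, h0.symm⟩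
    · obtain ⟨z, hzk, hz, hz0⟩ := exists_isotropic_of_neg_of_pos
        (LinearMap.ker (R₁ + R₂).mulVecLin) (x := x) (y := y) hxk
        hyk hxn h0
      exact h ⟨z, hz, hzk, hz0⟩
  · refine .inl (betaPlus_pos_of_pos_on_ker hJ₁ hR₁ hR₂ fun y hy hyk ↦ ?_)
    by_contra! hyn
    rcases hyn.eq_or_lt with h0 | h0
    · exact h ⟨y, hy, hyk, h0⟩
    · exact hneg ⟨y, hy, hyk, h0⟩

end pencil

theorem theorem4p18 (n : ℕ) (hn : 3 ≤ n)
    (J₁ R₁ J₂ R₂ : Matrix (Fin n) (Fin n) ℂ)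
    (hJ₁ : J₁ᴴ = -J₁) (hJ₂ : J₂ᴴ = -J₂)
    (hR₁ : R₁.PosSemidef) (hR₂ : R₂.PosSemidef) :
    (¬ HasCommonIsotropicVector ![R₁, R₂, J₁] →
      (0 < betaPlus R₁ R₂ J₁ ∧
        matrixNumericalRange (pencil J₁ R₁ J₂ R₂) ∩ openUpperRegion (betaPlus R₁ R₂ J₁) = ∅) ∨
      (0 < betaMinus R₁ R₂ J₁ ∧
        matrixNumericalRange (pencil J₁ R₁ J₂ R₂) ∩ openLowerRegion (betaMinus R₁ R₂ J₁) = ∅)) ∧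
    (¬ HasCommonIsotropicVector ![R₁, R₂] ↔
      LinearMap.ker R₁.mulVecLin ⊓ LinearMap.ker R₂.mulVecLin = ⊥) ∧
    (LinearMap.ker R₁.mulVecLin ⊓ LinearMap.ker R₂.mulVecLin = ⊥ →
      0 < betaMinus R₁ R₂ J₁ ∧ 0 < betaPlus R₁ R₂ J₁ ∧
      matrixNumericalRange (pencil J₁ R₁ J₂ R₂) ∩ upperRegion (betaPlus R₁ R₂ J₁) = ∅ ∧
      matrixNumericalRange (pencil J₁ R₁ J₂ R₂) ∩ lowerRegion (betaMinus R₁ R₂ J₁) = ∅) := by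

  have hker : LinearMap.ker R₁.mulVecLin ⊓ LinearMap.ker R₂.mulVecLin = ⊥ ↔
      ∀ x, x ≠ 0 → ¬ (R₁ *ᵥ x = 0 ∧ R₂ *ᵥ x = 0) := by
    simp only [Submodule.eq_bot_iff, Submodule.mem_inf, LinearMap.mem_ker,
      Matrix.mulVecLin_apply]
    exact forall_congr' fun x ↦ ⟨fun h hx hk ↦ hx (h hk), fun h hk ↦ by_contra fun hx ↦ h hx hk⟩
  refine ⟨fun h ↦ ?_, ?_, fun h ↦ ?_⟩
  · refine (betaPlus_pos_or_betaMinus_pos hJ₁ hR₁ hR₂ h).imp (fun hp ↦ ⟨hp, ?_⟩)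
      (fun hm ↦ ⟨hm, ?_⟩)
    · refine Set.eq_empty_of_forall_notMem ?_
      rintro z ⟨⟨x, hx, hxz⟩, hz, him⟩
      exact notMem_upperRegion_of_form_eq_zero hR₁ hR₂ hx
        (re_pencil_form_eq_zero hJ₁ hJ₂ hR₁.isHermitian hR₂.isHermitian hxz) (.inl him) hz
    · refine Set.eq_empty_of_forall_notMem ?_
      rintro z ⟨⟨x, hx, hxz⟩, hz, him⟩
      exact notMem_lowerRegion_of_form_eq_zero hR₁ hR₂ hx
        (re_pencil_form_eq_zero hJ₁ hJ₂ hR₁.isHermitian hR₂.isHermitian hxz) (.inl him) hz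
  · rw [hasCommonIsotropicVector_pair_iff hR₁ hR₂, hker]
    simp only [not_exists, not_and]
  · have hk : ∀ x, x ≠ 0 → (R₁ + R₂) *ᵥ x ≠ 0 := fun x hx hk ↦
      hker.1 h x hx ((hR₁.add_mulVec_eq_zero_iff hR₂ x).1 hk)
    have hpos : ∀ x, x ≠ 0 → 0 < reQuadForm R₁ x + reQuadForm R₂ x := fun x hx ↦ by
      rw [← reQuadForm_add]
      exact ((hR₁.add hR₂).reQuadForm_nonneg x).lt_of_ne' fun h0 ↦
        hk x hx (((hR₁.add hR₂).reQuadForm_eq_zero_iff x).1 h0)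
    -- The kernel of `R₁ + R₂` is trivial, so both sign conditions on it are vacuous.
    refine ⟨betaMinus_pos_of_neg_on_ker hJ₁ hR₁ hR₂ fun x hx h0 ↦ (hk x hx h0).elim,
      betaPlus_pos_of_pos_on_ker hJ₁ hR₁ hR₂ fun x hx h0 ↦ (hk x hx h0).elim,
      Set.eq_empty_of_forall_notMem ?_, Set.eq_empty_of_forall_notMem ?_⟩
    · rintro z ⟨⟨x, hx, hxz⟩, hz⟩
      exact notMem_upperRegion_of_form_eq_zero hR₁ hR₂ hx
        (re_pencil_form_eq_zero hJ₁ hJ₂ hR₁.isHermitian hR₂.isHermitian hxz) (.inr (hpos x hx)) hz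
    · rintro z ⟨⟨x, hx, hxz⟩, hz⟩
      exact notMem_lowerRegion_of_form_eq_zero hR₁ hR₂ hx
        (re_pencil_form_eq_zero hJ₁ hJ₂ hR₁.isHermitian hR₂.isHermitian hxz) (.inr (hpos x hx)) hz
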